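/- \textbf{The system.} Let $(N,E)$ be a power network: $N$ is a finite set of buses and $E\subseteq N\times N$ a set of lines forming a connected graph with an arbitrary orientation ($(i,j)\in E$ implies $(j,i)\notin E$). Let $\tilde E\subseteq N\times N$ be the links of a connected communication graph, also arbitrarily oriented. Fix constants $B_{ij}>0$ for $(i,j)\in E$, $\gamma_{ij}>0$ for $(i,j)\in\tilde E$, and for $j\in N$ constants $M_j,\tau_j,\alpha_j,A_j,\gamma_j,\overline d_j>0$, $p^L_j\in\mathbb R$, $\omega^1_j>\omega^0_j>0$ and $\overline p^c_j>\underline p^c_j$. The state is $\zeta=(\eta,\omega,p^M,p^c,\psi,\sigma)$ in $\mathcal M:=\mathbb R^{E}\times\mathbb R^{N}\times\mathbb R^{N}\times\mathbb R^{N}\times\mathbb R^{\tilde E}\times\{0,1\}^{N}$. The flow map $\hat f$ is given by \begin{align*} \dot\eta_{ij}&=\omega_i-\omega_j, && (i,j)\in E,\\ M_j\dot\omega_j&=-p^L_j+p^M_j-(\overline d_j\sigma_j+A_j\omega_j)-\sum_{k:(j,k)\in E}B_{jk}\eta_{jk}+\sum_{i:(i,j)\in E}B_{ij}\eta_{ij},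 && j\in N,\\ \tau_j\dot p^M_j&=-(p^M_j+\alpha_j\omega_j), && j\in N,\\ \gamma_{ij}\dot\psi_{ij}&=p^c_i-p^c_j, && (i,j)\in\tilde E,\\ \gamma_j\dot p^c_j&=-p^L_j-\frac{p^c_j}{|N|}-\sum_{k:(j,k)\in\tilde E}\psi_{jk}+\sum_{i:(i,j)\in\tilde E}\psi_{ij}, && j\in N,\\ \dot\sigma_j&=0, && j\in N. \end{align*} The flow set is $\overline F=\{\zeta\in\mathcal M:\sigma_j\in\mathcal J_j(\omega_j,p^c_j)\ \forall j\in N\}$, where $\mathcal J_j(w,p)=\{1\}$ if $w>\omega^1_j$ or $p>\overline p^c_j$, $\mathcal J_j(w,p)=\{0\}$ if $w<\omega^0_j$ and $p<\underline p^c_j$, and $\mathcal J_j(w,p)=\{0,1\}$ otherwise. The jump set is $\overline G=(\mathcal M\setminus\overline F)\cup\{\zeta\in\mathcal M:\sigma_j\in\mathcal I^D_j(\omega_j,p^c_j)\text{ for some }j\in N\}$, where $\mathcal I^D_j(w,p)=\{0\}$ if $w=\omega^1_j$ or $p=\overline p^c_j$, $\mathcal I^D_j(w,p)=\{1\}$ if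 ($w\le\omega^0_j$ and $p=\underline p^c_j$) or ($w=\omega^0_j$ and $p\le\underline p^c_j$), and $\mathcal I^D_j(w,p)=\emptyset$ otherwise. The jump map $\hat g$ leaves $\eta,\omega,p^M,p^c,\psi$ unchanged and sets, for each $j\in N$, $\sigma_j^+=1$ if $\omega_j\ge\omega^1_j$ or $p^c_j\ge\overline p^c_j$, $\sigma_j^+=0$ if $\omega_j\le\omega^0_j$ and $p^c_j\le\underline p^c_j$, and $\sigma_j^+=\sigma_j$ otherwise. \textbf{Solutions.} A \emph{hybrid time domain} $K\subseteq\mathbb R_{\ge0}\times\mathbb N_0$ is a union of a nonempty finite or infinite sequence of sets $[t_l,t_{l+1}]\times\{l\}$, $0=t_0\le t_1\le\dots$, where the last one, if it exists, may also be $[t_l,t_{l+1})\times\{l\}$ with $t_l<t_{l+1}$, or $[t_l,\infty)\times\{l\}$. A \emph{solution} is a map $\zeta$ on a hybrid time domain $K$, with $t\mapsto\zeta(t,l)$ locally absolutely continuous on $T_l=\{t:(t,l)\in K\}$ for each $l$, such that $\zeta(0,0)\in\overline F\cup\overline G$; for every $l$ such that $T_l$ has nonempty interior, $\zeta(t,l)\in\overline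 F$ for all $t\in\operatorname{int}T_l$ and $\dot\zeta(t,l)=\hat f(\zeta(t,l))$ for almost all $t\in T_l$; and whenever $(t,l),(t,l+1)\in K$, $\zeta(t,l)\in\overline G$ and $\zeta(t,l+1)=\hat g(\zeta(t,l))$. It is \emph{complete} if $K$ is unbounded, \emph{maximal} if it is not the restriction of a solution on a strictly larger hybrid time domain, and \emph{bounded} if its values form a bounded set. A \emph{switch} of load $j$ is a jump from $(t,l)\in K$ to $(t,l+1)\in K$ with $\sigma_j(t,l+1)\ne\sigma_j(t,l)$; $t_{1,j}\le t_{2,j}\le\dots$ denote the times of the successive switches of load $j$. \textbf{Proposition.} (i) For every $\zeta_0\in\mathcal M$ there is a complete solution with $\zeta(0,0)=\zeta_0$. (ii) All maximal solutions are complete. (iii) For every complete bounded solution there exists $\tau>0$ such that $t_{i+2,j}-t_{i,j}\ge\tau$ for all $j\in N$ and all $i\ge1$ for which load $j$ has an $(i+2)$-th switch; and there is no Zeno behaviour or chattering: for every $T$ there is $L$ such that $l\le L$ for all $(t,l)\in K$ with $t\le T$. -/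

import Mathlib

open Set MeasureTheory

/-! ### Hybrid systems: hybrid time domains, solutions, completeness, maximality -/

/-- A hybrid time domain: a union of an infinite sequence of intervals
`[t_l, t_{l+1}] × {l}`, `0 = t_0 ≤ t_1 ≤ …`, or of a finite sequence of them whose last member
may also be of the form `[t_L, t_{L+1}) × {L}` or `[t_L, ∞) × {L}`. -/
def IsHybridTimeDomain (K : Set (ℝ × ℕ)) : Prop :=
  ∃ t : ℕ → ℝ, t 0 = 0 ∧ Monotone t ∧
    (K = {p | p.1 ∈ Icc (t p.2) (t (p.2 + 1))} ∨
      ∃ (L : ℕ) (I : Set ℝ),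
        (I = Icc (t L) (t (L + 1)) ∨
          (t L < t (L + 1) ∧ I = Ico (t L) (t (L + 1))) ∨
          I = Ici (t L)) ∧
        K = {p | (p.2 < L ∧ p.1 ∈ Icc (t p.2) (t (p.2 + 1))) ∨ (p.2 = L ∧ p.1 ∈ I)})

/-- The `l`-th time interval `T_l = {t : (t, l) ∈ K}`. -/
def timeSlice (K : Set (ℝ × ℕ)) (l : ℕ) : Set ℝ := {t | (t, l) ∈ K}

/-- A hybrid system `(C, f, D, g)`: flow `ζ' = f ζ` on `C`, jumps `ζ⁺ = g ζ` on `D`. -/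
structure HybridSystem (X : Type*) where
  flowSet : Set X
  flow : X → X
  jumpSet : Set X
  jump : X → X

namespace HybridSystem

variable {X : Type*} [NormedAddCommGroup X] [NormedSpace ℝ X]

/-- `ζ`, restricted to the hybrid time domain `K`, is a solution of the hybrid system `H`.
The values of `ζ` outside `K` are irrelevant. -/
structure IsSolution (H : HybridSystem X) (K : Set (ℝ × ℕ)) (ζ : ℝ → ℕ → X) : Prop where
  domain : IsHybridTimeDomain K
  locallyAbsolutelyContinuous : ∀ l : ℕ, ∀ a ∈ timeSlice K l, ∀ b ∈ timeSlice K l, a ≤ b →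
    AbsolutelyContinuousOnInterval (fun t => ζ t l) a b
  initial : ζ 0 0 ∈ H.flowSet ∪ H.jumpSet
  flow_mem : ∀ l : ℕ, ∀ t ∈ interior (timeSlice K l), ζ t l ∈ H.flowSet
  flow_eq : ∀ l : ℕ, (interior (timeSlice K l)).Nonempty →
    ∀ᵐ t ∂(volume.restrict (timeSlice K l)),
      HasDerivWithinAt (fun s => ζ s l) (H.flow (ζ t l)) (timeSlice K l) t
  jump_mem : ∀ (t : ℝ) (l : ℕ), (t, l) ∈ K → (t, l + 1) ∈ K → ζ t l ∈ H.jumpSet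
  jump_eq : ∀ (t : ℝ) (l : ℕ), (t, l) ∈ K → (t, l + 1) ∈ K → ζ t (l + 1) = H.jump (ζ t l)

/-- A solution is complete if its hybrid time domain is unbounded. -/
def IsCompleteSolution (H : HybridSystem X) (K : Set (ℝ × ℕ)) (ζ : ℝ → ℕ → X) : Prop :=
  H.IsSolution K ζ ∧ ¬ Bornology.IsBounded K

/-- A solution is maximal if no other solution properly extends it. -/
def IsMaximalSolution (H : HybridSystem X) (K : Set (ℝ × ℕ)) (ζ : ℝ → ℕ → X) : Prop :=
  H.IsSolution K ζ ∧
    ¬ ∃ (K' : Set (ℝ × ℕ)) (ζ' : ℝ → ℕ → X), H.IsSolution K' ζ' ∧ K ⊂ K' ∧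
      ∀ (t : ℝ) (l : ℕ), (t, l) ∈ K → ζ t l = ζ' t l

end HybridSystem

/-- `ζ` takes values in a bounded set along the hybrid time domain `K`. -/
def IsBoundedOn {X : Type*} [NormedAddCommGroup X] (K : Set (ℝ × ℕ)) (ζ : ℝ → ℕ → X) : Prop :=
  Bornology.IsBounded {z : X | ∃ (t : ℝ) (l : ℕ), (t, l) ∈ K ∧ z = ζ t l}

/-! ### The power network with hysteretic loads and distributed power command -/

/-- A directed graph with an arbitrary orientation of each of its links: if `(i, j)` is a link,
then `(j, i)` is not (in particular there are no loops). -/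
def IsOrientedLinkSet {N : Type*} (E : Finset (N × N)) : Prop :=
  ∀ i j : N, (i, j) ∈ E → (j, i) ∉ E

/-- The graph obtained by forgetting the orientation of the links is connected. -/
def IsConnectedLinkSet {N : Type*} (E : Finset (N × N)) : Prop :=
  (SimpleGraph.fromRel (fun i j : N => (i, j) ∈ E)).Connected

/-- The data of the power network with set of buses `N`. -/
structure PowerNetwork (N : Type*) where
  /-- transmission lines -/
  E : Finset (N × N)
  oriented : IsOrientedLinkSet E
  connected : IsConnectedLinkSet E
  /-- links of the communication graph -/
  Ec : Finset (N × N)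
  comm_oriented : IsOrientedLinkSet Ec
  comm_connected : IsConnectedLinkSet Ec
  /-- line susceptances -/
  B : E → ℝ
  B_pos : ∀ e, 0 < B e
  /-- generator inertia -/
  M : N → ℝ
  M_pos : ∀ j, 0 < M j
  /-- generation time constants -/
  τ : N → ℝ
  τ_pos : ∀ j, 0 < τ j
  /-- droop coefficients -/
  α : N → ℝ
  α_pos : ∀ j, 0 < α j
  /-- damping coefficients -/
  A : N → ℝ
  A_pos : ∀ j, 0 < A j
  /-- frequency-independent uncontrollable load -/
  pL : N → ℝ
  /-- magnitude of the on-off load -/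
  d : N → ℝ
  d_pos : ∀ j, 0 < d j
  /-- lower frequency threshold -/
  ω0 : N → ℝ
  /-- upper frequency threshold -/
  ω1 : N → ℝ
  ω0_pos : ∀ j, 0 < ω0 j
  ω0_lt_ω1 : ∀ j, ω0 j < ω1 j
  /-- lower power command threshold -/
  pcLow : N → ℝ
  /-- upper power command threshold -/
  pcUp : N → ℝ
  pcLow_lt_pcUp : ∀ j, pcLow j < pcUp j
  /-- controller constants of the buses -/
  γ : N → ℝ
  γ_pos : ∀ j, 0 < γ j
  /-- controller constants of the communication links -/
  γc : Ec → ℝ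
  γc_pos : ∀ e, 0 < γc e

/-- `inflow E q j` is the sum of `q` over the links entering `j` minus the sum of `q` over the
links leaving `j`, i.e. `∑_{i : i → j} q_{ij} - ∑_{k : j → k} q_{jk}`. -/
def inflow {N : Type*} [DecidableEq N] (E : Finset (N × N)) (q : E → ℝ) (j : N) : ℝ :=
  (∑ e : E, if e.1.2 = j then q e else 0) - ∑ e : E, if e.1.1 = j then q e else 0

namespace PowerNetwork

variable {N : Type*}

/-- States `(η, ω, p^M, p^c, ψ, σ)`; the switching states `σ_j` are real coordinates that are
restricted to `{0, 1}` by `stateSpace`. -/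
abbrev State (S : PowerNetwork N) : Type _ :=
  (S.E → ℝ) × (N → ℝ) × (N → ℝ) × (N → ℝ) × (S.Ec → ℝ) × (N → ℝ)

variable (S : PowerNetwork N)

/-- power angle differences -/
def η (z : S.State) : S.E → ℝ := z.1
/-- frequency deviations -/
def ω (z : S.State) : N → ℝ := z.2.1
/-- mechanical power injections -/
def pM (z : S.State) : N → ℝ := z.2.2.1
/-- power command variables -/
def pc (z : S.State) : N → ℝ := z.2.2.2.1
/-- integrators of the power command differences -/
def ψ (z : S.State) : S.Ec → ℝ := z.2.2.2.2.1
/-- switching states of the loads -/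
def σ (z : S.State) : N → ℝ := z.2.2.2.2.2

/-- The space in which the states evolve: each `σ_j` is `0` or `1`. -/
def stateSpace : Set S.State := {z | ∀ j, S.σ z j = 0 ∨ S.σ z j = 1}

open Classical in
/-- Switching states of load `j` that are admissible during flow, given frequency `w` and local
power command `p`. The last case is
`ω⁰ ≤ w ≤ ω¹, p ≤ pcUp`, or `w ≤ ω⁰, pcLow ≤ p ≤ pcUp`. -/
noncomputable def flowLevels (j : N) (w p : ℝ) : Set ℝ :=
  if S.ω1 j < w ∨ S.pcUp j < p then {1}
  else if w < S.ω0 j ∧ p < S.pcLow j then {0}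
  else {0, 1}

open Classical in
/-- Switching states of load `j` from which it may switch at a threshold, given frequency `w` and
local power command `p`. -/
noncomputable def switchLevels (j : N) (w p : ℝ) : Set ℝ :=
  if w = S.ω1 j ∨ p = S.pcUp j then {0}
  else if (w ≤ S.ω0 j ∧ p = S.pcLow j) ∨ (w = S.ω0 j ∧ p ≤ S.pcLow j) then {1}
  else ∅

/-- The set on which the continuous dynamics are valid. -/
def flowRegion : Set S.State :=
  {z ∈ S.stateSpace | ∀ j, S.σ z j ∈ S.flowLevels j (S.ω z j) (S.pc z j)}

/-- The set on which the discrete update is valid: the states outside the flow region, and those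
at which some load is at one of its switching thresholds. -/
def jumpRegion : Set S.State :=
  (S.stateSpace \ S.flowRegion) ∪
    {z ∈ S.stateSpace | ∃ j, S.σ z j ∈ S.switchLevels j (S.ω z j) (S.pc z j)}

/-- The continuous dynamics. -/
noncomputable def vectorField [Fintype N] [DecidableEq N] (z : S.State) : S.State :=
  (fun e => S.ω z e.1.1 - S.ω z e.1.2,
   fun j => (-S.pL j + S.pM z j - (S.d j * S.σ z j + S.A j * S.ω z j)
      + inflow S.E (fun e => S.B e * S.η z e) j) / S.M j,
   fun j => -(S.pM z j + S.α j * S.ω z j) / S.τ j,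
   fun j => (-S.pL j - S.pc z j / (Fintype.card N : ℝ) + inflow S.Ec (S.ψ z) j) / S.γ j,
   fun e => (S.pc z e.1.1 - S.pc z e.1.2) / S.γc e,
   fun _ => 0)

open Classical in
/-- The updated switching state of load `j`. -/
noncomputable def switchUpdate (z : S.State) (j : N) : ℝ :=
  if S.ω1 j ≤ S.ω z j ∨ S.pcUp j ≤ S.pc z j then 1
  else if S.ω z j ≤ S.ω0 j ∧ S.pc z j ≤ S.pcLow j then 0
  else S.σ z j

/-- The discrete update: only the switching states change. -/
noncomputable def update (z : S.State) : S.State :=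
  (S.η z, S.ω z, S.pM z, S.pc z, S.ψ z, S.switchUpdate z)

/-- The hybrid system of the network with hysteretic loads and distributed power command. -/
noncomputable def hybridSystem [Fintype N] [DecidableEq N] : HybridSystem S.State where
  flowSet := S.flowRegion
  flow := S.vectorField
  jumpSet := S.jumpRegion
  jump := S.update

/-- Load `j` switches at the hybrid time `(t, l)`: the trajectory jumps there from `(t, l)` to
`(t, l + 1)`, and the jump changes `σ_j`. -/
def IsSwitch (K : Set (ℝ × ℕ)) (ζ : ℝ → ℕ → S.State) (j : N) (t : ℝ) (l : ℕ) : Prop :=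
  (t, l) ∈ K ∧ (t, l + 1) ∈ K ∧ S.σ (ζ t (l + 1)) j ≠ S.σ (ζ t l) j

/-- `(t, l)` and `(t', l')` are consecutive switches of load `j`. -/
def AreConsecutiveSwitches (K : Set (ℝ × ℕ)) (ζ : ℝ → ℕ → S.State) (j : N)
    (t : ℝ) (l : ℕ) (t' : ℝ) (l' : ℕ) : Prop :=
  S.IsSwitch K ζ j t l ∧ S.IsSwitch K ζ j t' l' ∧ l < l' ∧
    ∀ (s : ℝ) (k : ℕ), l < k → k < l' → ¬ S.IsSwitch K ζ j s k

end PowerNetwork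

/-! The continuous dynamics are affine, so they have a global flow `Φ` and are Lipschitz. A solution
is therefore nothing but flow lines of `Φ` glued together at the jumps: an absolutely continuous
function satisfying the equation almost everywhere satisfies the integral equation, hence is C¹, and
Gronwall uniqueness applies.

Existence and completeness use only a few facts about the hybrid system, collected in `IsViable`:
the flow and the jumps keep the state space `M` invariant, `M` is covered by the flow and jump sets,
and the jump set is closed. A complete solution arises by flowing until the first time the jump set
is hit, jumping, and repeating; closedness makes that time attained. A solution whose domain ends at
a finite time is never maximal: a half-open end can be closed, a final state in the jump set allows
a jump, and any other final state has a neighbourhood that misses the jump set, so flowing goes on.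

The closedness comes from `mem_jumpRegion_iff`: the flow conditions are violated strictly beyond the
thresholds, the extra part of the jump set supplies the thresholds themselves, and the union is
given by non-strict inequalities.

The dwell time is hysteresis. A load turns on when one of `ω`, `pc` is at or above its upper
threshold, and off only when both are at or below their lower ones. Its switches alternate, so
between consecutive ones some coordinate crosses a gap between thresholds. Along a bounded solution
the vector field is bounded and jumps do not move these coordinates, so the crossing takes a minimal
time; even two consecutive switches are separated. Every jump switches at least one load, so the
finitely many loads allow only boundedly many jumps by time `T`. -/

/-! ### Global flows of affine vector fields, and Carathéodory solutions -/

/-- `Φ t x` is the value at time `t` of a global solution of `x' = f x` starting at `x`. -/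
structure IsGlobalFlow {X : Type*} [NormedAddCommGroup X] [NormedSpace ℝ X]
    (f : X → X) (Φ : ℝ → X → X) : Prop where
  zero : ∀ x, Φ 0 x = x
  hasDerivAt : ∀ x t, HasDerivAt (fun s => Φ s x) (f (Φ t x)) t

section Flow

variable {X : Type*} [NormedAddCommGroup X] [NormedSpace ℝ X]

theorem IsGlobalFlow.continuous {f : X → X} {Φ : ℝ → X → X} (h : IsGlobalFlow f Φ) (x : X) :
    Continuous fun s => Φ s x :=
  continuous_iff_continuousAt.2 fun t => (h.hasDerivAt x t).continuousAt

theorem IsGlobalFlow.hasDerivAt_sub {f : X → X} {Φ : ℝ → X → X} (h : IsGlobalFlow f Φ)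
    (x : X) (a t : ℝ) : HasDerivAt (fun s => Φ (s - a) x) (f (Φ (t - a) x)) t :=
  (h.hasDerivAt x (t - a)).comp_sub_const t a

theorem IsGlobalFlow.contDiff_sub {f : X → X} {Φ : ℝ → X → X} (h : IsGlobalFlow f Φ)
    (hf : Continuous f) (x : X) (a : ℝ) : ContDiff ℝ 1 fun s => Φ (s - a) x := by
  refine contDiff_one_iff_deriv.2 ⟨fun t => (h.hasDerivAt_sub x a t).differentiableAt, ?_⟩
  have : deriv (fun s => Φ (s - a) x) = fun t => f (Φ (t - a) x) :=
    funext fun t => (h.hasDerivAt_sub x a t).deriv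
  rw [this]
  exact hf.comp ((h.continuous x).comp (continuous_id.sub continuous_const))

/-- An affine field on `X` becomes linear on `X × ℝ` when the constant term is multiplied by an
extra coordinate with zero derivative. The exponential flow started at `(x, 1)` keeps that
coordinate equal to 1, and its first component solves the affine equation. -/
theorem exists_isGlobalFlow_affine [CompleteSpace X] (A : X →L[ℝ] X) (b : X) :
    ∃ Φ : ℝ → X → X, IsGlobalFlow (fun x => A x + b) Φ := by
  let Ah : (X × ℝ) →L[ℝ] (X × ℝ) :=
    (A.comp (ContinuousLinearMap.fst ℝ X ℝ) +
      (ContinuousLinearMap.snd ℝ X ℝ).smulRight b).prod 0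
  let v : ℝ → X → X × ℝ := fun t x => NormedSpace.exp (t • Ah) (x, 1)
  have hv : ∀ x t, HasDerivAt (fun s => v s x) (Ah (v t x)) t := fun x t =>
    (hasDerivAt_exp_smul_const' (𝕂 := ℝ) Ah t).clm_apply (hasDerivAt_const t (x, (1 : ℝ)))
      |>.congr_deriv (by simp [v])
  have hv0 : ∀ x, v 0 x = (x, 1) := fun x => by simp [v]
  have hsnd : ∀ x t, (v t x).2 = 1 := by
    intro x t
    have hd : ∀ s, HasDerivAt (fun s => (v s x).2) 0 s := fun s => by
      simpa [Ah] using! (ContinuousLinearMap.snd ℝ X ℝ).hasFDerivAt.comp_hasDerivAt s (hv x s)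
    have := is_const_of_deriv_eq_zero (fun s => (hd s).differentiableAt)
      (fun s => (hd s).deriv) t 0
    simpa [hv0] using this
  refine ⟨fun t x => (v t x).1, fun x => by simp [hv0], fun x t => ?_⟩
  have := (ContinuousLinearMap.fst ℝ X ℝ).hasFDerivAt.comp_hasDerivAt t (hv x t)
  simpa [Ah, hsnd x t] using! this

/-- An absolutely continuous solution of `y' = f y` almost everywhere is a flow line. -/
theorem AbsolutelyContinuousOnInterval.eq_flow [CompleteSpace X] {f : X → X} {Φ : ℝ → X → X}
    {C : NNReal} (hf : LipschitzWith C f) (hΦ : IsGlobalFlow f Φ) {y : ℝ → X} {a b : ℝ}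
    (hab : a ≤ b) (hy : AbsolutelyContinuousOnInterval y a b)
    (hd : ∀ᵐ t, t ∈ Ioo a b → HasDerivAt y (f (y t)) t) :
    ∀ t ∈ Icc a b, y t = Φ (t - a) (y a) := by
  have hyc : ContinuousOn y (Icc a b) := by simpa [uIcc_of_le hab] using hy.continuousOn
  -- Extending `y` by its endpoint values makes the integrand continuous on all of `ℝ`, so `h` is C¹
  -- everywhere and no one-sided derivatives of the integral are needed.
  let u : ℝ → X := IccExtend hab ((Icc a b).domRestrict y)
  have huc : Continuous u := hyc.domRestrict.Icc_extend'
  have hu : ∀ t ∈ Icc a b, u t = y t := fun t ht => by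
    simp [u, IccExtend_of_mem hab _ ht, domRestrict_apply]
  have hfu : Continuous fun t => f (u t) := hf.continuous.comp huc
  let h : ℝ → X := fun t => ∫ s in a..t, f (u s)
  have hh : ∀ t, HasDerivAt h (f (u t)) t := fun t =>
    intervalIntegral.integral_hasDerivAt_right (hfu.intervalIntegrable _ _)
      hfu.stronglyMeasurable.stronglyMeasurableAtFilter hfu.continuousAt
  have hhC : ContDiff ℝ 1 h := by
    refine contDiff_one_iff_deriv.2 ⟨fun t => (hh t).differentiableAt, ?_⟩
    rw [show deriv h = fun t => f (u t) from funext fun t => (hh t).deriv]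
    exact hfu
  -- `y - h` is absolutely continuous with derivative zero almost everywhere, hence constant. This
  -- upgrades the equation for `y` from almost every time to every time.
  have hg : AbsolutelyContinuousOnInterval (fun t => y t - h t) a b :=
    hy.fun_sub hhC.contDiffOn.absolutelyContinuousOnInterval
  have hg0 : ∀ᵐ t, t ∈ uIcc a b → HasDerivAt (fun t => y t - h t) 0 t := by
    have ha : ∀ᵐ t : ℝ, t ≠ a := by simp [ae_iff]
    have hb : ∀ᵐ t : ℝ, t ≠ b := by simp [ae_iff]
    filter_upwards [hd, ha, hb] with t ht hta htb hmem
    rw [uIcc_of_le hab] at hmem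
    have hmem' : t ∈ Ioo a b :=
      ⟨lt_of_le_of_ne hmem.1 (Ne.symm hta), lt_of_le_of_ne hmem.2 htb⟩
    simpa [hu t hmem] using! (ht hmem').sub (hh t)
  obtain ⟨c, hc⟩ := hg.const_of_ae_hasDerivAt_zero hg0
  rw [uIcc_of_le hab] at hc
  have hyh : ∀ t ∈ Icc a b, y t = c + h t := fun t ht => by rw [← hc t ht]; abel
  have key : EqOn y (fun t => Φ (t - a) (y a)) (Icc a b) := by
    refine ODE_solution_unique (v := fun _ => f) (K := C) (fun _ => hf) hyc ?_
      ((hΦ.continuous _).comp (continuous_id.sub continuous_const)).continuousOn ?_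
      (by simp [hΦ.zero])
    · intro t ht
      have hI : Icc a b ∈ nhdsWithin t (Ici t) :=
        mem_nhdsWithin.2 ⟨Iio b, isOpen_Iio, ht.2, fun s hs => ⟨ht.1.trans hs.2, hs.1.le⟩⟩
      have h1 : HasDerivWithinAt (fun t => c + h t) (f (u t)) (Ici t) t :=
        ((hh t).const_add c).hasDerivWithinAt
      rw [hu t (Ico_subset_Icc_self ht)] at h1
      refine h1.congr_of_eventuallyEq ?_ (hyh t (Ico_subset_Icc_self ht))
      filter_upwards [hI] with s hs using hyh s hs
    · intro t ht
      exact (hΦ.hasDerivAt_sub _ a t).hasDerivWithinAt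
  exact key

end Flow

/-! ### Hybrid time domains -/

/-- Jump times of a hybrid time domain. -/
theorem IsHybridTimeDomain.exists_jumpTimes {K : Set (ℝ × ℕ)} (hK : IsHybridTimeDomain K) :
    ∃ t : ℕ → ℝ, t 0 = 0 ∧ Monotone t ∧ (0, 0) ∈ K ∧
      (∀ s l, (s, l) ∈ K → t l ≤ s ∧ (t l, l) ∈ K) ∧
      (∀ l, (timeSlice K l).OrdConnected) ∧
      ∀ s l, (s, l + 1) ∈ K → (t (l + 1), l) ∈ K ∧ ∀ s', (s', l) ∈ K → s' ≤ t (l + 1) := by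
  obtain ⟨t, h0, ht, rfl | ⟨L, I, hI, rfl⟩⟩ := hK
  · refine ⟨t, h0, ht, ?_, ?_, ?_, ?_⟩
    · exact ⟨h0.le, h0 ▸ ht (Nat.zero_le 1)⟩
    · exact fun s l h => ⟨h.1, le_rfl, ht (Nat.le_succ l)⟩
    · exact fun l => (ordConnected_Icc : (Icc (t l) (t (l + 1))).OrdConnected)
    · exact fun s l h => ⟨⟨ht (Nat.le_succ l), le_rfl⟩, fun s' h' => h'.2⟩
  · have hIL : t L ∈ I := by
      rcases hI with rfl | ⟨hlt, rfl⟩ | rfl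
      · exact ⟨le_rfl, ht (Nat.le_succ L)⟩
      · exact ⟨le_rfl, hlt⟩
      · exact mem_Ici.2 le_rfl
    have hIge : ∀ s ∈ I, t L ≤ s := by
      rcases hI with rfl | ⟨hlt, rfl⟩ | rfl
      · exact fun s h => h.1
      · exact fun s h => h.1
      · exact fun s h => h
    have hIo : I.OrdConnected := by
      rcases hI with rfl | ⟨hlt, rfl⟩ | rfl
      · exact ordConnected_Icc
      · exact ordConnected_Ico
      · exact ordConnected_Ici
    refine ⟨t, h0, ht, ?_, ?_, ?_, ?_⟩
    · rcases Nat.eq_zero_or_pos L with rfl | hL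
      · exact Or.inr ⟨rfl, h0 ▸ hIL⟩
      · exact Or.inl ⟨hL, h0.le, h0 ▸ ht (Nat.zero_le 1)⟩
    · rintro s l (⟨hl, hs⟩ | ⟨hl, hs⟩)
      · exact ⟨hs.1, Or.inl ⟨hl, le_rfl, ht (Nat.le_succ l)⟩⟩
      · obtain rfl : l = L := hl
        exact ⟨hIge s hs, Or.inr ⟨rfl, hIL⟩⟩
    · intro l
      rcases lt_trichotomy l L with h | rfl | h
      · convert! (ordConnected_Icc : (Icc (t l) (t (l + 1))).OrdConnected) using 1
        ext s; simp [timeSlice, h, h.ne]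
      · convert! hIo using 1
        ext s; simp [timeSlice]
      · convert! (ordConnected_empty : (∅ : Set ℝ).OrdConnected) using 1
        ext s; simp [timeSlice, h.not_gt, h.ne']
    · intro s l h
      have hl : l < L := by
        rcases h with ⟨h, -⟩ | ⟨h, -⟩ <;> simp only at h <;> omega
      refine ⟨Or.inl ⟨hl, ht (Nat.le_succ l), le_rfl⟩, ?_⟩
      rintro s' (⟨-, h'⟩ | ⟨h', -⟩)
      · exact h'.2
      · exact absurd h' hl.ne

/-- The hybrid time domain with jump times `t 1 ≤ … ≤ t L` that ends at the time `b`. -/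
def closedTimeDomain (t : ℕ → ℝ) (L : ℕ) (b : ℝ) : Set (ℝ × ℕ) :=
  {p | (p.2 < L ∧ p.1 ∈ Icc (t p.2) (t (p.2 + 1))) ∨ (p.2 = L ∧ p.1 ∈ Icc (t L) b)}

theorem isHybridTimeDomain_closedTimeDomain {t : ℕ → ℝ} (h0 : t 0 = 0) (ht : Monotone t)
    {L : ℕ} {b : ℝ} (hb : t L ≤ b) : IsHybridTimeDomain (closedTimeDomain t L b) := by
  -- The value `b` beyond `L` keeps the sequence monotone and makes its entry at `L + 1` the right
  -- end of the last interval.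
  refine ⟨fun n => if n ≤ L then t n else b, by simp [h0], ?_, Or.inr ⟨L, Icc (t L) b, ?_, ?_⟩⟩
  · intro m n hmn
    dsimp only
    split_ifs with hm hn hn
    · exact ht hmn
    · exact (ht hm).trans hb
    · omega
    · exact le_rfl
  · simp
  · ext ⟨s, l⟩
    simp only [closedTimeDomain, mem_ofPred_eq]
    refine or_congr (and_congr_right fun hl => ?_) Iff.rfl
    rw [if_pos hl.le, if_pos (Nat.succ_le_of_lt hl)]

theorem timeSlice_closedTimeDomain_of_lt {t : ℕ → ℝ} {L l : ℕ} {b : ℝ} (h : l < L) :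
    timeSlice (closedTimeDomain t L b) l = Icc (t l) (t (l + 1)) := by
  ext s; simp [timeSlice, closedTimeDomain, h, h.ne]

theorem timeSlice_closedTimeDomain_self {t : ℕ → ℝ} {L : ℕ} {b : ℝ} :
    timeSlice (closedTimeDomain t L b) L = Icc (t L) b := by
  ext s; simp [timeSlice, closedTimeDomain]

theorem not_isBounded_of_forall_nat {K : Set (ℝ × ℕ)} (h : ∀ l, ∃ s, (s, l) ∈ K) :
    ¬ Bornology.IsBounded K := by
  intro hb
  have h2 : Bornology.IsBounded (univ : Set ℕ) :=
    hb.image_snd.subset fun l _ => (h l).elim fun s hs => ⟨(s, l), hs, rfl⟩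
  obtain ⟨r, hr⟩ := Metric.isBounded_iff_subset_closedBall (0 : ℕ) |>.1 h2
  exact Set.infinite_univ ((isCompact_closedBall (0 : ℕ) r).finite_of_discrete.subset hr)

theorem not_isBounded_of_forall_ge {K : Set (ℝ × ℕ)} {a : ℝ} {l : ℕ}
    (h : ∀ s, a ≤ s → (s, l) ∈ K) : ¬ Bornology.IsBounded K := by
  intro hb
  have h2 : Bornology.IsBounded (Ici a) :=
    hb.image_fst.subset fun s hs => ⟨(s, l), h s hs, rfl⟩
  exact not_bddAbove_Ici a h2.bddAbove

/-! ### Solutions as glued flow lines; existence of complete solutions -/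

namespace HybridSystem

variable {X : Type*} [NormedAddCommGroup X] [NormedSpace ℝ X]

/-- On each time interval a solution follows the flow. -/
theorem IsSolution.eq_flow [CompleteSpace X] {H : HybridSystem X} {Φ : ℝ → X → X} {C : NNReal}
    (hf : LipschitzWith C H.flow) (hΦ : IsGlobalFlow H.flow Φ) {K : Set (ℝ × ℕ)}
    {ζ : ℝ → ℕ → X} (h : H.IsSolution K ζ) {a s : ℝ} {l : ℕ} (ha : (a, l) ∈ K)
    (hs : (s, l) ∈ K) (has : a ≤ s) : ζ s l = Φ (s - a) (ζ a l) := by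
  obtain ⟨t, -, -, -, -, hord, -⟩ := h.domain.exists_jumpTimes
  have hsub : Icc a s ⊆ timeSlice K l := (hord l).out ha hs
  have hsub' : Ioo a s ⊆ interior (timeSlice K l) :=
    interior_maximal (Ioo_subset_Icc_self.trans hsub) isOpen_Ioo
  rcases has.eq_or_lt with rfl | hlt
  · simp [hΦ.zero]
  have hne : (interior (timeSlice K l)).Nonempty := (nonempty_Ioo.2 hlt).mono hsub'
  refine (h.locallyAbsolutelyContinuous l a ha s hs has).eq_flow hf hΦ has ?_ s
    (right_mem_Icc.2 has)
  have := ae_imp_of_ae_restrict (h.flow_eq l hne)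
  filter_upwards [this] with r hr hmem
  exact (hr (hsub (Ioo_subset_Icc_self hmem))).hasDerivAt
    (mem_interior_iff_mem_nhds.1 (hsub' hmem))

/-- Flow lines pieced together at jumps form a solution. -/
theorem isSolution_of_flow {H : HybridSystem X} {Φ : ℝ → X → X} (hf : Continuous H.flow)
    (hΦ : IsGlobalFlow H.flow Φ) {K : Set (ℝ × ℕ)} (hK : IsHybridTimeDomain K)
    {t : ℕ → ℝ} {x : ℕ → X} (h0 : t 0 = 0) (hx : x 0 ∈ H.flowSet ∪ H.jumpSet)
    (hflow : ∀ l, ∀ s ∈ interior (timeSlice K l), Φ (s - t l) (x l) ∈ H.flowSet)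
    (hjump : ∀ s l, (s, l) ∈ K → (s, l + 1) ∈ K → s = t (l + 1) ∧
      Φ (s - t l) (x l) ∈ H.jumpSet ∧ x (l + 1) = H.jump (Φ (s - t l) (x l))) :
    H.IsSolution K fun s l => Φ (s - t l) (x l) where
  domain := hK
  locallyAbsolutelyContinuous l a _ b _ _ :=
    (hΦ.contDiff_sub hf (x l) (t l)).contDiffOn.absolutelyContinuousOnInterval
  initial := by simpa [h0, hΦ.zero] using hx
  flow_mem := hflow
  flow_eq l _ := Filter.Eventually.of_forall fun s =>
    (hΦ.hasDerivAt_sub (x l) (t l) s).hasDerivWithinAt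
  jump_mem s l h h' := (hjump s l h h').2.1
  jump_eq s l h h' := by
    obtain ⟨rfl, -, h3⟩ := hjump s l h h'
    simp only [sub_self, hΦ.zero, h3]

/-- The basic conditions for the existence and continuation of solutions: the flow is complete
and preserves a set `M` of states on which it is always possible to flow or to jump. -/
structure IsViable (H : HybridSystem X) (M : Set X) (Φ : ℝ → X → X) : Prop where
  lipschitz : ∃ C, LipschitzWith C H.flow
  isGlobalFlow : IsGlobalFlow H.flow Φ
  flow_mem : ∀ z ∈ M, ∀ t, Φ t z ∈ M
  jump_mem : ∀ z ∈ H.jumpSet, H.jump z ∈ M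
  flowSet_subset : H.flowSet ⊆ M
  jumpSet_subset : H.jumpSet ⊆ M
  subset_union : M ⊆ H.flowSet ∪ H.jumpSet
  isClosed_jumpSet : IsClosed H.jumpSet

/-- Induction on the number of jumps: the initial state lies in `M`, and both the flow and the jumps
stay there. -/
theorem IsViable.mem [CompleteSpace X] {H : HybridSystem X} {M : Set X} {Φ : ℝ → X → X}
    (hV : H.IsViable M Φ) {K : Set (ℝ × ℕ)} {ζ : ℝ → ℕ → X} (h : H.IsSolution K ζ) {s : ℝ}
    {l : ℕ} (hs : (s, l) ∈ K) : ζ s l ∈ M := by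
  obtain ⟨C, hC⟩ := hV.lipschitz
  obtain ⟨t, h0, -, -, hleft, -, hpred⟩ := h.domain.exists_jumpTimes
  induction l generalizing s with
  | zero =>
    obtain ⟨hle, hmem⟩ := hleft s 0 hs
    rw [h.eq_flow hC hV.isGlobalFlow hmem hs hle, h0]
    exact hV.flow_mem _ ((union_subset hV.flowSet_subset hV.jumpSet_subset) h.initial) _
  | succ l ih =>
    obtain ⟨hle, hmem⟩ := hleft s _ hs
    rw [h.eq_flow hC hV.isGlobalFlow hmem hs hle,
      h.jump_eq _ _ (hpred s l hs).1 hmem]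
    exact hV.flow_mem _ (hV.jump_mem _ (h.jump_mem _ _ (hpred s l hs).1 hmem)) _

/-- From every state in `M` there is a solution with an unbounded time domain. -/
theorem IsViable.exists_isCompleteSolution {H : HybridSystem X} {M : Set X} {Φ : ℝ → X → X}
    (hV : H.IsViable M Φ) {z₀ : X} (hz₀ : z₀ ∈ M) :
    ∃ (K : Set (ℝ × ℕ)) (ζ : ℝ → ℕ → X), H.IsCompleteSolution K ζ ∧ ζ 0 0 = z₀ := by
  obtain ⟨C, hC⟩ := hV.lipschitz
  have hΦ := hV.isGlobalFlow
  let hit : X → Set ℝ := fun z => {s | 0 ≤ s ∧ Φ s z ∈ H.jumpSet}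
  -- `T z` is the first hitting time of the jump set. If the set is never hit, `sInf ∅ = 0` is
  -- meaningless; that case is treated separately.
  let T : X → ℝ := fun z => sInf (hit z)
  have hT0 : ∀ z, 0 ≤ T z := fun z => Real.sInf_nonneg fun s hs => hs.1
  have hbdd : ∀ z, BddBelow (hit z) := fun z => ⟨0, fun s hs => hs.1⟩
  have hTmem : ∀ z, (hit z).Nonempty → Φ (T z) z ∈ H.jumpSet := fun z hz => by
    have hcl : IsClosed (hit z) :=
      isClosed_Ici.inter (hV.isClosed_jumpSet.preimage (hΦ.continuous z))
    exact (hcl.csInf_mem hz (hbdd z)).2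
  have hlt : ∀ z ∈ M, ∀ s, 0 ≤ s → s < T z → Φ s z ∈ H.flowSet := fun z hz s hs hsT =>
    (hV.subset_union (hV.flow_mem z hz s)).resolve_right fun hD =>
      (csInf_le (hbdd z) ⟨hs, hD⟩).not_gt hsT
  have hnever : ∀ z ∈ M, ¬ (hit z).Nonempty → ∀ s, 0 ≤ s → Φ s z ∈ H.flowSet :=
    fun z hz hn s hs => (hV.subset_union (hV.flow_mem z hz s)).resolve_right fun hD =>
      hn ⟨s, hs, hD⟩
  let y : ℕ → ℝ × X := fun n => Nat.rec (0, z₀) (fun _ p => (p.1 + T p.2, H.jump (Φ (T p.2) p.2))) n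
  let t : ℕ → ℝ := fun n => (y n).1
  let x : ℕ → X := fun n => (y n).2
  have ht0 : t 0 = 0 := rfl
  have hx0 : x 0 = z₀ := rfl
  have htS : ∀ n, t (n + 1) = t n + T (x n) := fun n => rfl
  have hxS : ∀ n, x (n + 1) = H.jump (Φ (T (x n)) (x n)) := fun n => rfl
  have htm : Monotone t := monotone_nat_of_le_succ fun n => by
    rw [htS]; linarith [hT0 (x n)]
  have hxM : ∀ n, (∀ k < n, (hit (x k)).Nonempty) → x n ∈ M := by
    intro n hn
    cases n with
    | zero => exact hx0 ▸ hz₀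
    | succ n =>
      rw [hxS]
      exact hV.jump_mem _ (hTmem _ (hn n n.lt_succ_self))
  have hstep : ∀ l, (hit (x l)).Nonempty → ∀ s, s = t (l + 1) → s = t (l + 1) ∧
      Φ (s - t l) (x l) ∈ H.jumpSet ∧ x (l + 1) = H.jump (Φ (s - t l) (x l)) := by
    rintro l hl s rfl
    have : t (l + 1) - t l = T (x l) := by rw [htS]; ring
    rw [this]
    exact ⟨rfl, hTmem _ hl, hxS l⟩
  have hmid : ∀ l, x l ∈ M → ∀ s ∈ interior (Icc (t l) (t (l + 1))),
      Φ (s - t l) (x l) ∈ H.flowSet := by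
    intro l hl s hs
    rw [interior_Icc] at hs
    have h2 := hs.2
    rw [htS] at h2
    exact hlt _ hl _ (by linarith [hs.1]) (by linarith)
  -- Either every flow line reaches the jump set and there are infinitely many jumps, or the first
  -- one that does not, with index `L`, is followed forever.
  by_cases hall : ∀ n, (hit (x n)).Nonempty
  · refine ⟨{p | p.1 ∈ Icc (t p.2) (t (p.2 + 1))}, fun s l => Φ (s - t l) (x l),
      ⟨isSolution_of_flow hC.continuous hΦ ⟨t, ht0, htm, Or.inl rfl⟩ ht0
        (hV.subset_union hz₀) ?_ ?_, ?_⟩, by simp [ht0, hx0, hΦ.zero]⟩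
    · exact fun l => hmid l (hxM l fun k _ => hall k)
    · exact fun s l h h' => hstep l (hall l) s (le_antisymm h.2 h'.1)
    · exact not_isBounded_of_forall_nat fun l => ⟨t l, le_rfl, htm (Nat.le_succ l)⟩
  · have hex : ∃ n, ¬ (hit (x n)).Nonempty := not_forall.1 hall
    classical
    obtain ⟨L, hL, hmin⟩ : ∃ L, ¬ (hit (x L)).Nonempty ∧ ∀ k < L, (hit (x k)).Nonempty :=
      ⟨Nat.find hex, Nat.find_spec hex, fun k hk => not_not.1 (Nat.find_min hex hk)⟩
    let K : Set (ℝ × ℕ) :=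
      {p | (p.2 < L ∧ p.1 ∈ Icc (t p.2) (t (p.2 + 1))) ∨ (p.2 = L ∧ p.1 ∈ Ici (t L))}
    refine ⟨K, fun s l => Φ (s - t l) (x l),
      ⟨isSolution_of_flow hC.continuous hΦ
        ⟨t, ht0, htm, Or.inr ⟨L, Ici (t L), by simp, rfl⟩⟩ ht0
        (hV.subset_union hz₀) ?_ ?_, ?_⟩, by simp [ht0, hx0, hΦ.zero]⟩
    · intro l s hs
      rcases lt_trichotomy l L with h | rfl | h
      · have hsl : timeSlice K l = Icc (t l) (t (l + 1)) := by
          ext s; simp [K, timeSlice, h, h.ne]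
        rw [hsl] at hs
        exact hmid l (hxM l fun k hk => hmin k (hk.trans h)) s hs
      · have hsl : timeSlice K l = Ici (t l) := by
          ext s; simp [K, timeSlice]
        rw [hsl] at hs
        exact hnever _ (hxM l hmin) hL _ (sub_nonneg.2 (interior_subset hs))
      · have hsl : timeSlice K l = ∅ := by
          ext s; simp [K, timeSlice, h.not_gt, h.ne']
        rw [hsl, interior_empty] at hs
        exact hs.elim
    · intro s l h h'
      have hl : l < L := by
        rcases h' with ⟨h', -⟩ | ⟨h', -⟩ <;> simp only at h' <;> omega
      refine hstep l (hmin l hl) s (le_antisymm ?_ ?_)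
      · rcases h with ⟨-, h⟩ | ⟨h, -⟩
        · exact h.2
        · exact absurd h hl.ne
      · rcases h' with ⟨-, h'⟩ | ⟨h'', h'⟩
        · exact h'.1
        · simp only at h''
          rw [h'']; exact h'
    · exact not_isBounded_of_forall_ge (a := t L) (l := L) fun s hs => Or.inr ⟨rfl, hs⟩

end HybridSystem

/-! ### Continuation of solutions; maximal solutions are complete -/

namespace HybridSystem

variable {X : Type*} [NormedAddCommGroup X] [NormedSpace ℝ X]

/-- A solution on a finite hybrid time domain can be continued as long as the flow remains in the
flow set. -/
theorem IsSolution.exists_flow_extension [CompleteSpace X] {H : HybridSystem X}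
    {Φ : ℝ → X → X} {C : NNReal} (hC : LipschitzWith C H.flow) (hΦ : IsGlobalFlow H.flow Φ)
    {K : Set (ℝ × ℕ)} {ζ : ℝ → ℕ → X} (h : H.IsSolution K ζ) {t : ℕ → ℝ} {L : ℕ} {I : Set ℝ}
    {b : ℝ} (h0 : t 0 = 0) (ht : Monotone t)
    (hK : K = {p | (p.2 < L ∧ p.1 ∈ Icc (t p.2) (t (p.2 + 1))) ∨ (p.2 = L ∧ p.1 ∈ I)})
    (hI : t L ∈ I) (hIb : I ⊂ Icc (t L) b)
    (hflow : ∀ s ∈ Ioo (t L) b, Φ (s - t L) (ζ (t L) L) ∈ H.flowSet) :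
    ∃ (K' : Set (ℝ × ℕ)) (ζ' : ℝ → ℕ → X), H.IsSolution K' ζ' ∧ K ⊂ K' ∧
      ∀ (s : ℝ) (l : ℕ), (s, l) ∈ K → ζ s l = ζ' s l := by
  have hlow : ∀ l, l < L → ∀ s, (s, l) ∈ K ↔ s ∈ Icc (t l) (t (l + 1)) := fun l hl s => by
    simp [hK, hl, hl.ne]
  have htop : ∀ s, (s, L) ∈ K ↔ s ∈ I := fun s => by simp [hK]
  have hnot : ∀ s l, L < l → (s, l) ∉ K := fun s l hl => by
    simp [hK, hl.not_gt, hl.ne']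
  have hleft : ∀ s l, (s, l) ∈ K → t l ≤ s ∧ (t l, l) ∈ K := by
    intro s l hs
    rcases lt_trichotomy l L with hl | rfl | hl
    · exact ⟨((hlow l hl s).1 hs).1, (hlow l hl _).2 ⟨le_rfl, ht (Nat.le_succ l)⟩⟩
    · exact ⟨(hIb.1 ((htop s).1 hs)).1, (htop _).2 hI⟩
    · exact absurd hs (hnot s l hl)
  have hrep : ∀ s l, (s, l) ∈ K → ζ s l = Φ (s - t l) (ζ (t l) l) := fun s l hs =>
    h.eq_flow hC hΦ (hleft s l hs).2 hs (hleft s l hs).1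
  -- The extension follows `Φ` from the left end of each slice; `hrep` says that on `K` this is the
  -- old solution.
  refine ⟨closedTimeDomain t L b, fun s l => Φ (s - t l) (ζ (t l) l),
    isSolution_of_flow hC.continuous hΦ
      (isHybridTimeDomain_closedTimeDomain h0 ht (nonempty_Icc.1 ⟨_, hIb.1 hI⟩)) h0
      (by simpa only [h0] using h.initial) ?_ ?_, ?_, hrep⟩
  · intro l s hs
    rcases lt_trichotomy l L with hl | rfl | hl
    · have hsl : timeSlice (closedTimeDomain t L b) l = timeSlice K l := by
        rw [timeSlice_closedTimeDomain_of_lt hl]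
        ext r
        exact (hlow l hl r).symm
      rw [hsl] at hs
      rw [← hrep s l (interior_subset hs : s ∈ timeSlice K l)]
      exact h.flow_mem l s hs
    · rw [timeSlice_closedTimeDomain_self, interior_Icc] at hs
      exact hflow s hs
    · have hsl : timeSlice (closedTimeDomain t L b) l = ∅ := by
        ext s; simp [closedTimeDomain, timeSlice, hl.not_gt, hl.ne']
      rw [hsl, interior_empty] at hs
      exact hs.elim
  · intro s l hs hs'
    have hl : l < L := by
      rcases hs' with ⟨h', -⟩ | ⟨h', -⟩ <;> simp only at h' <;> omega
    have hsI : s ∈ Icc (t l) (t (l + 1)) := by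
      rcases hs with ⟨-, h'⟩ | ⟨h', -⟩
      · exact h'
      · exact absurd h' hl.ne
    have hge : t (l + 1) ≤ s := by
      rcases hs' with ⟨-, h'⟩ | ⟨h'', h'⟩
      · exact h'.1
      · simp only at h''
        rw [h'']; exact h'.1
    obtain rfl : s = t (l + 1) := le_antisymm hsI.2 hge
    have h1 : (t (l + 1), l) ∈ K := (hlow l hl _).2 hsI
    have h2 : (t (l + 1), l + 1) ∈ K := by
      rcases (Nat.succ_le_of_lt hl).lt_or_eq with h' | h'
      · exact (hlow _ h' _).2 ⟨le_rfl, ht (Nat.le_succ _)⟩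
      · obtain rfl : l + 1 = L := h'
        exact (htop _).2 hI
    rw [← hrep _ _ h1]
    exact ⟨rfl, h.jump_mem _ _ h1 h2, h.jump_eq _ _ h1 h2⟩
  · refine ⟨?_, fun hsub => hIb.2 fun s hs => (htop s).1 (hsub (Or.inr ⟨rfl, hs⟩))⟩
    rw [hK]
    rintro ⟨s, l⟩ (hs | ⟨hl, hs⟩)
    · exact Or.inl hs
    · exact Or.inr ⟨hl, hIb.1 hs⟩

/-- A solution on a closed finite hybrid time domain whose final state lies in the jump set can be
continued by a jump. -/
theorem IsSolution.exists_jump_extension [CompleteSpace X] {H : HybridSystem X}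
    {Φ : ℝ → X → X} {C : NNReal} (hC : LipschitzWith C H.flow) (hΦ : IsGlobalFlow H.flow Φ)
    {K : Set (ℝ × ℕ)} {ζ : ℝ → ℕ → X} (h : H.IsSolution K ζ) {t : ℕ → ℝ} {L : ℕ}
    (h0 : t 0 = 0) (ht : Monotone t) (hK : K = closedTimeDomain t L (t (L + 1)))
    (hjump : ζ (t (L + 1)) L ∈ H.jumpSet) :
    ∃ (K' : Set (ℝ × ℕ)) (ζ' : ℝ → ℕ → X), H.IsSolution K' ζ' ∧ K ⊂ K' ∧
      ∀ (s : ℝ) (l : ℕ), (s, l) ∈ K → ζ s l = ζ' s l := by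
  have hlow : ∀ l, l ≤ L → ∀ s, (s, l) ∈ K ↔ s ∈ Icc (t l) (t (l + 1)) := fun l hl s => by
    rcases hl.lt_or_eq with hl | rfl
    · simp [hK, closedTimeDomain, hl, hl.ne]
    · simp [hK, closedTimeDomain]
  have hle : ∀ s l, (s, l) ∈ K → l ≤ L := by
    rw [hK]
    rintro s l (⟨h', -⟩ | ⟨h', -⟩)
    · exact h'.le
    · exact h'.le
  have hrep : ∀ s l, (s, l) ∈ K → ζ s l = Φ (s - t l) (ζ (t l) l) := fun s l hs => by
    have hs' := (hlow l (hle s l hs) s).1 hs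
    exact h.eq_flow hC hΦ ((hlow l (hle s l hs) _).2 ⟨le_rfl, ht (Nat.le_succ l)⟩) hs hs'.1
  let x : ℕ → X := fun l => if l ≤ L then ζ (t l) l else H.jump (ζ (t (L + 1)) L)
  have hx : ∀ l, l ≤ L → x l = ζ (t l) l := fun l hl => if_pos hl
  have hx' : x (L + 1) = H.jump (ζ (t (L + 1)) L) := if_neg (by omega)
  have hlow' : ∀ l, l ≤ L → ∀ s, (s, l) ∈ closedTimeDomain t (L + 1) (t (L + 1)) ↔ (s, l) ∈ K :=
    fun l hl s => by
      rw [hlow l hl s]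
      simp only [closedTimeDomain, mem_ofPred_eq]
      constructor
      · rintro (⟨-, h'⟩ | ⟨h', -⟩)
        · exact h'
        · omega
      · exact fun h' => Or.inl ⟨Nat.lt_succ_of_le hl, h'⟩
  refine ⟨closedTimeDomain t (L + 1) (t (L + 1)), fun s l => Φ (s - t l) (x l),
    isSolution_of_flow hC.continuous hΦ
      (isHybridTimeDomain_closedTimeDomain h0 ht le_rfl) h0
      (by simpa only [hx 0 (Nat.zero_le L), h0] using h.initial) ?_ ?_, ?_, ?_⟩
  · intro l s hs
    rcases Nat.lt_trichotomy l (L + 1) with hl | rfl | hl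
    · have hl' : l ≤ L := Nat.le_of_lt_succ hl
      have hsl : timeSlice (closedTimeDomain t (L + 1) (t (L + 1))) l = timeSlice K l := by
        ext r
        exact hlow' l hl' r
      rw [hsl] at hs
      rw [hx l hl', ← hrep s l (interior_subset hs : s ∈ timeSlice K l)]
      exact h.flow_mem l s hs
    -- The slice added by the jump is a single instant, so nothing has to flow there.
    · rw [timeSlice_closedTimeDomain_self, interior_Icc, Ioo_self] at hs
      exact hs.elim
    · have hsl : timeSlice (closedTimeDomain t (L + 1) (t (L + 1))) l = ∅ := by
        refine eq_empty_of_forall_notMem fun r hr => ?_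
        rcases hr with ⟨h', -⟩ | ⟨h', -⟩ <;> simp only at h' <;> omega
      rw [hsl, interior_empty] at hs
      exact hs.elim
  · intro s l hs hs'
    have hl : l ≤ L := by
      rcases hs' with ⟨h', -⟩ | ⟨h', -⟩ <;> simp only at h' <;> omega
    have h1 : (s, l) ∈ K := (hlow' l hl s).1 hs
    have hsI := (hlow l hl s).1 h1
    have hge : t (l + 1) ≤ s := by
      rcases hs' with ⟨-, h'⟩ | ⟨h'', h'⟩
      · exact h'.1
      · simp only at h''
        rw [h'']; exact h'.1
    obtain rfl : s = t (l + 1) := le_antisymm hsI.2 hge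
    rw [hx l hl, ← hrep _ _ h1]
    rcases hl.lt_or_eq with hl | rfl
    · have h2 : (t (l + 1), l + 1) ∈ K :=
        (hlow (l + 1) hl _).2 ⟨le_rfl, ht (Nat.le_succ _)⟩
      rw [hx (l + 1) hl]
      exact ⟨rfl, h.jump_mem _ _ h1 h2, h.jump_eq _ _ h1 h2⟩
    · exact ⟨rfl, hjump, hx'⟩
  · refine ⟨fun ⟨s, l⟩ hs => (hlow' l (hle s l hs) s).2 hs, fun hsub => ?_⟩
    have : (t (L + 1), L + 1) ∈ K := hsub (Or.inr ⟨rfl, le_rfl, le_rfl⟩)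
    have := hle _ _ this
    omega
  · intro s l hs
    simp only [hx l (hle s l hs)]
    exact hrep s l hs

/-- Only infinitely many slices or a final half-line survive: a compact final interval can be
prolonged by a jump or by flowing, and a half-open one by its endpoint. -/
theorem IsViable.isCompleteSolution_of_isMaximalSolution [CompleteSpace X]
    {H : HybridSystem X} {M : Set X} {Φ : ℝ → X → X} (hV : H.IsViable M Φ) {K : Set (ℝ × ℕ)}
    {ζ : ℝ → ℕ → X} (hmax : H.IsMaximalSolution K ζ) : H.IsCompleteSolution K ζ := by
  obtain ⟨C, hC⟩ := hV.lipschitz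
  have hΦ := hV.isGlobalFlow
  obtain ⟨h, hext⟩ := hmax
  refine ⟨h, ?_⟩
  obtain ⟨t, h0, ht, hK | ⟨L, I, hI, hK⟩⟩ := h.domain
  · exact not_isBounded_of_forall_nat fun l => ⟨t l, by
      rw [hK]; exact ⟨le_rfl, ht (Nat.le_succ l)⟩⟩
  have htop : ∀ s, (s, L) ∈ K ↔ s ∈ I := fun s => by simp [hK]
  rcases hI with rfl | ⟨hlt, rfl⟩ | rfl
  · refine (hext ?_).elim
    have hLL : t L ≤ t (L + 1) := ht (Nat.le_succ L)
    have hleft : (t L, L) ∈ K := (htop _).2 ⟨le_rfl, hLL⟩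
    have hlast : (t (L + 1), L) ∈ K := (htop _).2 ⟨hLL, le_rfl⟩
    by_cases hD : ζ (t (L + 1)) L ∈ H.jumpSet
    · exact h.exists_jump_extension hC hΦ h0 ht hK hD
    · have hrep : ∀ s ∈ Icc (t L) (t (L + 1)), ζ s L = Φ (s - t L) (ζ (t L) L) := fun s hs =>
        h.eq_flow hC hΦ hleft ((htop s).2 hs) hs.1
      have hcont : Continuous fun s => Φ (s - t L) (ζ (t L) L) :=
        (hΦ.continuous _).comp (continuous_id.sub continuous_const)
      -- The complement of the jump set is open, and a state of `M` outside the jump set lies in the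
      -- flow set, so flowing is possible for a further time `ε`.
      have hopen : ∀ᶠ s in nhds (t (L + 1)), Φ (s - t L) (ζ (t L) L) ∉ H.jumpSet := by
        refine hcont.continuousAt.eventually_mem (hV.isClosed_jumpSet.isOpen_compl.mem_nhds ?_)
        rw [← hrep _ ⟨hLL, le_rfl⟩]
        exact hD
      obtain ⟨ε, hε, hball⟩ := Metric.eventually_nhds_iff.1 hopen
      refine h.exists_flow_extension hC hΦ (b := t (L + 1) + ε) h0 ht hK ⟨le_rfl, hLL⟩ ?_ ?_
      · refine ⟨Icc_subset_Icc_right (by linarith), fun hsub => ?_⟩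
        have : t (L + 1) + ε ∈ Icc (t L) (t (L + 1)) := hsub ⟨by linarith, le_rfl⟩
        linarith [this.2]
      · intro s hs
        rcases lt_or_ge s (t (L + 1)) with hs' | hs'
        · rw [← hrep s ⟨hs.1.le, hs'.le⟩]
          refine h.flow_mem L s (interior_maximal (t := Ioo (t L) (t (L + 1))) ?_ isOpen_Ioo
            ⟨hs.1, hs'⟩)
          exact fun r hr => (htop r).2 (Ioo_subset_Icc_self hr)
        · refine (hV.subset_union (hV.flow_mem _ (hV.mem h hleft) _)).resolve_right (hball ?_)
          rw [Real.dist_eq, abs_of_nonneg (by linarith)]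
          linarith [hs.2]
  -- Adding the missing endpoint imposes no new flow condition, since membership in the flow set is
  -- required only at interior times.
  · refine (hext ?_).elim
    have hleft : (t L, L) ∈ K := (htop _).2 ⟨le_rfl, hlt⟩
    refine h.exists_flow_extension hC hΦ (b := t (L + 1)) h0 ht hK ⟨le_rfl, hlt⟩ ?_ ?_
    · exact ⟨Ico_subset_Icc_self, fun hsub => lt_irrefl _ (hsub ⟨hlt.le, le_rfl⟩).2⟩
    · intro s hs
      rw [← h.eq_flow hC hΦ hleft ((htop s).2 (Ioo_subset_Ico_self hs)) hs.1.le]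
      refine h.flow_mem L s (interior_maximal (t := Ioo (t L) (t (L + 1))) ?_ isOpen_Ioo hs)
      exact fun r hr => (htop r).2 (Ioo_subset_Ico_self hr)
  · exact not_isBounded_of_forall_ge fun s hs => (htop s).2 hs

end HybridSystem

/-! ### The network dynamics are affine -/

theorem inflow_add {N : Type*} [DecidableEq N] (E : Finset (N × N)) (q q' : E → ℝ) (j : N) :
    inflow E (q + q') j = inflow E q j + inflow E q' j := by
  have h : ∀ (P : E → Prop) [DecidablePred P], (∑ e : E, if P e then (q + q') e else 0) =
      (∑ e : E, if P e then q e else 0) + ∑ e : E, if P e then q' e else 0 := fun P _ => by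
    rw [← Finset.sum_add_distrib]
    exact Finset.sum_congr rfl fun e _ => by split_ifs <;> simp
  unfold inflow
  rw [h, h]
  ring

theorem inflow_smul {N : Type*} [DecidableEq N] (E : Finset (N × N)) (c : ℝ) (q : E → ℝ)
    (j : N) : inflow E (c • q) j = c * inflow E q j := by
  simp only [inflow, mul_sub, Finset.mul_sum, mul_ite, mul_zero, Pi.smul_apply, smul_eq_mul]

namespace PowerNetwork

variable {N : Type*} (S : PowerNetwork N)

/-- The linear part of the continuous dynamics. -/
noncomputable def linearPart [Fintype N] [DecidableEq N] : S.State →ₗ[ℝ] S.State where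
  toFun z :=
    (fun e => S.ω z e.1.1 - S.ω z e.1.2,
     fun j => (S.pM z j - (S.d j * S.σ z j + S.A j * S.ω z j)
        + inflow S.E (fun e => S.B e * S.η z e) j) / S.M j,
     fun j => -(S.pM z j + S.α j * S.ω z j) / S.τ j,
     fun j => (-S.pc z j / (Fintype.card N : ℝ) + inflow S.Ec (S.ψ z) j) / S.γ j,
     fun e => (S.pc z e.1.1 - S.pc z e.1.2) / S.γc e,
     fun _ => 0)
  map_add' z z' := by
    have h : ∀ j, inflow S.E (fun e => S.B e * (S.η z e + S.η z' e)) j =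
        inflow S.E (fun e => S.B e * S.η z e) j + inflow S.E (fun e => S.B e * S.η z' e) j := by
      intro j
      rw [← inflow_add]
      congr 1; ext e; simp [mul_add]
    have h' : ∀ j, inflow S.Ec (S.ψ z + S.ψ z') j =
        inflow S.Ec (S.ψ z) j + inflow S.Ec (S.ψ z') j := fun j => inflow_add _ _ _ _
    simp only [η, ω, pM, pc, ψ, σ] at h h' ⊢
    refine Prod.ext ?_ (Prod.ext ?_ (Prod.ext ?_ (Prod.ext ?_ (Prod.ext ?_ ?_)))) <;> ext j <;>
      simp only [Prod.fst_add, Prod.snd_add, Pi.add_apply, h, h'] <;> ring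
  map_smul' c z := by
    have h : ∀ j, inflow S.E (fun e => S.B e * (c * S.η z e)) j =
        c * inflow S.E (fun e => S.B e * S.η z e) j := by
      intro j
      rw [← inflow_smul]
      congr 1; ext e; simp; ring
    have h' : ∀ j, inflow S.Ec (c • S.ψ z) j =
        c * inflow S.Ec (S.ψ z) j := fun j => inflow_smul _ _ _ _
    simp only [η, ω, pM, pc, ψ, σ] at h h' ⊢
    refine Prod.ext ?_ (Prod.ext ?_ (Prod.ext ?_ (Prod.ext ?_ (Prod.ext ?_ ?_)))) <;> ext j <;>
      simp only [Prod.smul_fst, Prod.smul_snd, Pi.smul_apply, smul_eq_mul, h, h',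
        RingHom.id_apply] <;> ring

/-- The constant part of the continuous dynamics. -/
noncomputable def constantPart : S.State :=
  (0, fun j => -S.pL j / S.M j, 0, fun j => -S.pL j / S.γ j, 0, 0)

theorem vectorField_eq [Fintype N] [DecidableEq N] (z : S.State) :
    S.vectorField z = S.linearPart z + S.constantPart := by
  refine Prod.ext ?_ (Prod.ext ?_ (Prod.ext ?_ (Prod.ext ?_ (Prod.ext ?_ ?_)))) <;> ext j <;>
    simp [vectorField, linearPart, constantPart] <;> ring

theorem exists_isGlobalFlow [Fintype N] [DecidableEq N] :
    ∃ Φ : ℝ → S.State → S.State, IsGlobalFlow S.vectorField Φ := by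
  have h : S.vectorField =
      fun z => LinearMap.toContinuousLinearMap S.linearPart z + S.constantPart :=
    funext S.vectorField_eq
  rw [h]
  exact exists_isGlobalFlow_affine _ _

theorem exists_lipschitzWith_vectorField [Fintype N] [DecidableEq N] :
    ∃ C, LipschitzWith C S.vectorField := by
  have h : S.vectorField =
      fun z => LinearMap.toContinuousLinearMap S.linearPart z + S.constantPart :=
    funext S.vectorField_eq
  rw [h]
  exact ⟨_, (LinearMap.toContinuousLinearMap S.linearPart).lipschitz.add
    (LipschitzWith.const S.constantPart)⟩

variable {S}

theorem σ_flow [Fintype N] [DecidableEq N] {Φ : ℝ → S.State → S.State}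
    (hΦ : IsGlobalFlow S.vectorField Φ) (z : S.State) (t : ℝ) : S.σ (Φ t z) = S.σ z := by
  let π : S.State →L[ℝ] (N → ℝ) :=
    ContinuousLinearMap.snd ℝ _ _ ∘L ContinuousLinearMap.snd ℝ _ _ ∘L
      ContinuousLinearMap.snd ℝ _ _ ∘L ContinuousLinearMap.snd ℝ _ _ ∘L
      ContinuousLinearMap.snd ℝ _ _
  have hd : ∀ s, HasDerivAt (fun s => π (Φ s z)) 0 s := fun s =>
    π.hasFDerivAt.comp_hasDerivAt s (hΦ.hasDerivAt z s)
  have := is_const_of_deriv_eq_zero (fun s => (hd s).differentiableAt) (fun s => (hd s).deriv) t 0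
  simpa [hΦ.zero] using! this

/-! ### Hysteresis: closed form of the jump set, and viability -/

/-- Load `j` is off although an upper threshold has been reached, or on although both lower
thresholds have been reached. -/
def NeedsSwitch (S : PowerNetwork N) (z : S.State) (j : N) : Prop :=
  (S.σ z j = 0 ∧ (S.ω1 j ≤ S.ω z j ∨ S.pcUp j ≤ S.pc z j)) ∨
    (S.σ z j = 1 ∧ S.ω z j ≤ S.ω0 j ∧ S.pc z j ≤ S.pcLow j)

/-- Leaving `flowLevels` means being strictly past the thresholds, while `switchLevels` adds the
boundary cases. Together they give the closed inequalities of `NeedsSwitch`. -/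
theorem mem_jumpRegion_iff {z : S.State} :
    z ∈ S.jumpRegion ↔ z ∈ S.stateSpace ∧ ∃ j, S.NeedsSwitch z j := by
  have hF : z ∈ S.stateSpace → (z ∉ S.flowRegion ↔
      ∃ j, S.σ z j ∉ S.flowLevels j (S.ω z j) (S.pc z j)) := fun hz => by
    simp [flowRegion, hz]
  have key : z ∈ S.stateSpace → ∀ j, (S.σ z j ∉ S.flowLevels j (S.ω z j) (S.pc z j) ∨
      S.σ z j ∈ S.switchLevels j (S.ω z j) (S.pc z j)) ↔ S.NeedsSwitch z j := by
    intro hz j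
    have h1 := S.ω0_lt_ω1 j
    have h2 := S.pcLow_lt_pcUp j
    rcases hz j with h | h <;> simp only [NeedsSwitch, flowLevels, switchLevels, h] <;>
      split_ifs <;> simp <;> grind
  constructor
  · rintro (⟨hz, hnF⟩ | ⟨hz, j, hj⟩)
    · obtain ⟨j, hj⟩ := (hF hz).1 hnF
      exact ⟨hz, j, (key hz j).1 (Or.inl hj)⟩
    · exact ⟨hz, j, (key hz j).1 (Or.inr hj)⟩
  · rintro ⟨hz, j, hj⟩
    rcases (key hz j).2 hj with h | h
    · exact Or.inl ⟨hz, (hF hz).2 ⟨j, h⟩⟩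
    · exact Or.inr ⟨hz, j, h⟩

/-- Excludes jumps that change nothing. The strict gaps between thresholds ensure that a load below
both lower ones is not also told to be on. -/
theorem NeedsSwitch.switchUpdate_ne {z : S.State} {j : N} (h : S.NeedsSwitch z j) :
    S.switchUpdate z j ≠ S.σ z j := by
  have h1 := S.ω0_lt_ω1 j
  have h2 := S.pcLow_lt_pcUp j
  unfold switchUpdate
  rcases h with ⟨hσ, h⟩ | ⟨hσ, h, h'⟩
  · rw [if_pos h, hσ]; norm_num
  · rw [if_neg (by rintro (h3 | h3) <;> linarith), if_pos ⟨h, h'⟩, hσ]; norm_num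

theorem needsSwitch_of_switchUpdate_ne {z : S.State} (hz : z ∈ S.stateSpace) {j : N}
    (h : S.switchUpdate z j ≠ S.σ z j) : S.NeedsSwitch z j := by
  unfold switchUpdate at h
  unfold NeedsSwitch
  rcases hz j with hσ | hσ <;> rw [hσ] at h ⊢ <;> split_ifs at h <;> simp_all

theorem update_mem_stateSpace {z : S.State} (hz : z ∈ S.stateSpace) :
    S.update z ∈ S.stateSpace := by
  intro j
  change S.switchUpdate z j = 0 ∨ S.switchUpdate z j = 1
  unfold switchUpdate
  split_ifs
  · exact Or.inr rfl
  · exact Or.inl rfl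
  · exact hz j

theorem isClosed_jumpRegion [Finite N] : IsClosed S.jumpRegion := by
  have hσ : ∀ j, Continuous fun z : S.State => S.σ z j := fun j => by unfold σ; fun_prop
  have hω : ∀ j, Continuous fun z : S.State => S.ω z j := fun j => by unfold ω; fun_prop
  have hp : ∀ j, Continuous fun z : S.State => S.pc z j := fun j => by unfold pc; fun_prop
  have h : S.jumpRegion = {z | ∀ j, S.σ z j = 0 ∨ S.σ z j = 1} ∩ ⋃ j, {z | S.NeedsSwitch z j} := by
    ext z
    rw [mem_jumpRegion_iff]
    simp [stateSpace]
  rw [h]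
  refine IsClosed.inter ?_ (isClosed_iUnion_of_finite fun j => ?_)
  · simp only [ofPred_forall]
    exact isClosed_iInter fun j => (isClosed_eq (hσ j) continuous_const).union
      (isClosed_eq (hσ j) continuous_const)
  · exact ((isClosed_eq (hσ j) continuous_const).inter
      ((isClosed_le continuous_const (hω j)).union (isClosed_le continuous_const (hp j)))).union
      ((isClosed_eq (hσ j) continuous_const).inter
        ((isClosed_le (hω j) continuous_const).inter (isClosed_le (hp j) continuous_const)))

theorem isViable [Fintype N] [DecidableEq N] {Φ : ℝ → S.State → S.State}
    (hΦ : IsGlobalFlow S.vectorField Φ) : S.hybridSystem.IsViable S.stateSpace Φ where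
  lipschitz := S.exists_lipschitzWith_vectorField
  isGlobalFlow := hΦ
  flow_mem z hz t j := by rw [σ_flow hΦ]; exact hz j
  jump_mem z hz := update_mem_stateSpace (mem_jumpRegion_iff.1 hz).1
  flowSet_subset z hz := hz.1
  jumpSet_subset z hz := (mem_jumpRegion_iff.1 hz).1
  subset_union z hz := by
    by_cases h : z ∈ S.flowRegion
    · exact Or.inl h
    · exact Or.inr (Or.inl ⟨hz, h⟩)
  isClosed_jumpSet := isClosed_jumpRegion

end PowerNetwork

/-! ### Dwell times between switches -/

/-- Hybrid times are ordered by their number of jumps. -/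
theorem IsHybridTimeDomain.le_of_lt {K : Set (ℝ × ℕ)} (hK : IsHybridTimeDomain K) {s s' : ℝ}
    {l l' : ℕ} (h : (s, l) ∈ K) (h' : (s', l') ∈ K) (hl : l < l') : s ≤ s' := by
  obtain ⟨t, -, ht, -, hleft, -, hpred⟩ := hK.exists_jumpTimes
  obtain ⟨m, rfl⟩ : ∃ m, l' = l + 1 + m := ⟨l' - (l + 1), by omega⟩
  have hmem : ∀ m s', (s', l + 1 + m) ∈ K → ∃ r, (r, l + 1) ∈ K := by
    intro m
    induction m with
    | zero => exact fun s' h' => ⟨s', h'⟩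
    | succ m ih => exact fun s' h' => ih _ (hpred s' _ h').1
  obtain ⟨r, hr⟩ := hmem m s' h'
  exact ((hpred r l hr).2 s h).trans ((ht (by omega)).trans (hleft s' _ h').1)

namespace HybridSystem

variable {X : Type*} [NormedAddCommGroup X] [NormedSpace ℝ X] [CompleteSpace X]

/-- An observable that is preserved by jumps varies along a solution no faster than the bound on
the flow map allows. -/
theorem IsSolution.abs_sub_le {H : HybridSystem X} {Φ : ℝ → X → X} {C : NNReal}
    (hf : LipschitzWith C H.flow) (hΦ : IsGlobalFlow H.flow Φ) {K : Set (ℝ × ℕ)}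
    {ζ : ℝ → ℕ → X} (h : H.IsSolution K ζ) {B : ℝ}
    (hB : ∀ s l, (s, l) ∈ K → ‖H.flow (ζ s l)‖ ≤ B) {q : X → ℝ}
    (hq : ∀ x y, |q x - q y| ≤ ‖x - y‖) (hqj : ∀ z, q (H.jump z) = q z)
    {s s' : ℝ} {l l' : ℕ} (hs : (s, l) ∈ K) (hs' : (s', l') ∈ K) (hss : s ≤ s') (hl : l ≤ l') :
    |q (ζ s' l') - q (ζ s l)| ≤ B * (s' - s) := by
  obtain ⟨t, -, -, -, hleft, hord, hpred⟩ := h.domain.exists_jumpTimes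
  have hslice : ∀ l a b, (a, l) ∈ K → (b, l) ∈ K → a ≤ b →
      |q (ζ b l) - q (ζ a l)| ≤ B * (b - a) := by
    intro l a b ha hb hab
    have hsub : Icc a b ⊆ timeSlice K l := (hord l).out ha hb
    have hrep : ∀ r ∈ Icc a b, ζ r l = Φ (r - a) (ζ a l) := fun r hr =>
      h.eq_flow hf hΦ ha (hsub hr) hr.1
    have := norm_image_sub_le_of_norm_deriv_le_segment' (f := fun r => Φ (r - a) (ζ a l))
      (C := B) (fun r _ => (hΦ.hasDerivAt_sub (ζ a l) a r).hasDerivWithinAt)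
      (fun r hr => by
        rw [← hrep r (Ico_subset_Icc_self hr)]
        exact hB r l (hsub (Ico_subset_Icc_self hr))) b ⟨hab, le_rfl⟩
    rw [← hrep b ⟨hab, le_rfl⟩, ← hrep a ⟨le_rfl, hab⟩] at this
    exact (hq _ _).trans this
  induction l', hl using Nat.le_induction generalizing s' with
  | base => exact hslice l s s' hs hs' hss
  | succ m hm ih =>
    obtain ⟨hle, hmem⟩ := hleft s' _ hs'
    have hmem' := (hpred s' m hs').1
    have hst : s ≤ t (m + 1) := h.domain.le_of_lt hs hmem (Nat.lt_succ_of_le hm)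
    have h1 := ih hmem' hst
    have h2 := hslice (m + 1) _ _ hmem hs' hle
    rw [h.jump_eq _ _ hmem' hmem, hqj] at h2
    calc |q (ζ s' (m + 1)) - q (ζ s l)|
        ≤ |q (ζ s' (m + 1)) - q (ζ (t (m + 1)) m)| + |q (ζ (t (m + 1)) m) - q (ζ s l)| :=
          _root_.abs_sub_le _ _ _
      _ ≤ B * (s' - t (m + 1)) + B * (t (m + 1) - s) := add_le_add h2 h1
      _ = B * (s' - s) := by ring

end HybridSystem

/-! ### Dwell times and the bound on the number of jumps in the network -/

namespace PowerNetwork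

variable {N : Type*} [Fintype N] [DecidableEq N] {S : PowerNetwork N} {K : Set (ℝ × ℕ)}
  {ζ : ℝ → ℕ → S.State}

/-- `σ` is constant along the flow, so it can change only at jumps, and a jump that changes `σ j` is
a switch of load `j`. -/
theorem σ_eq_of_forall_not_isSwitch (h : S.hybridSystem.IsSolution K ζ) {j : N} {s s' : ℝ}
    {l l' : ℕ} (hs : (s, l) ∈ K) (hs' : (s', l') ∈ K) (hl : l ≤ l')
    (hno : ∀ r k, l ≤ k → k < l' → ¬ S.IsSwitch K ζ j r k) :
    S.σ (ζ s' l') j = S.σ (ζ s l) j := by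
  obtain ⟨Φ, hΦ⟩ := S.exists_isGlobalFlow
  have hV := isViable hΦ
  obtain ⟨C, hC⟩ := hV.lipschitz
  obtain ⟨t, -, -, -, hleft, -, hpred⟩ := h.domain.exists_jumpTimes
  have hslice : ∀ l a, (a, l) ∈ K → S.σ (ζ a l) j = S.σ (ζ (t l) l) j := fun l a ha => by
    obtain ⟨hle, hmem⟩ := hleft a l ha
    rw [h.eq_flow hC hV.isGlobalFlow hmem ha hle, σ_flow hΦ]
  induction l', hl using Nat.le_induction generalizing s' with
  | base => rw [hslice l s' hs', hslice l s hs]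
  | succ m hm ih =>
    have hmem := (hleft s' _ hs').2
    have hmem' := (hpred s' m hs').1
    rw [hslice _ s' hs', ← ih hmem' fun r k hk hkm => hno r k hk (hkm.trans m.lt_succ_self)]
    by_contra hne
    exact hno (t (m + 1)) m hm m.lt_succ_self ⟨hmem', hmem, hne⟩

/-- Along a bounded solution the times of consecutive switches of a load are separated. -/
theorem exists_dwellTime (h : S.hybridSystem.IsSolution K ζ) (hb : IsBoundedOn K ζ) :
    ∃ τ : ℝ, 0 < τ ∧ ∀ (j : N) (t t' : ℝ) (l l' : ℕ),
      S.AreConsecutiveSwitches K ζ j t l t' l' → τ ≤ t' - t := by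
  obtain ⟨Φ, hΦ⟩ := S.exists_isGlobalFlow
  have hV := isViable hΦ
  obtain ⟨C, hC⟩ := hV.lipschitz
  obtain ⟨B, hB0, hB⟩ : ∃ B : ℝ, 0 < B ∧ ∀ s l, (s, l) ∈ K → ‖S.hybridSystem.flow (ζ s l)‖ ≤ B := by
    obtain ⟨B, hB0, hB⟩ := (hC.isBounded_image hb).exists_pos_norm_le
    exact ⟨B, hB0, fun s l hs => hB _ ⟨_, ⟨s, l, hs, rfl⟩, rfl⟩⟩
  obtain ⟨δ, hδ0, hδ⟩ : ∃ δ : ℝ, 0 < δ ∧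
      ∀ j, δ ≤ S.ω1 j - S.ω0 j ∧ δ ≤ S.pcUp j - S.pcLow j := by
    have hev : ∀ᶠ δ in nhdsWithin (0 : ℝ) (Ioi 0),
        ∀ j, δ ≤ S.ω1 j - S.ω0 j ∧ δ ≤ S.pcUp j - S.pcLow j := by
      refine Filter.eventually_all.2 fun j => nhdsWithin_le_nhds ?_
      filter_upwards [Iic_mem_nhds (sub_pos.2 (S.ω0_lt_ω1 j)),
        Iic_mem_nhds (sub_pos.2 (S.pcLow_lt_pcUp j))] with δ h1 h2 using ⟨h1, h2⟩
    obtain ⟨δ, hδ, hδ0⟩ := (hev.and self_mem_nhdsWithin).exists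
    exact ⟨δ, hδ0, hδ⟩
  -- `δ` is at most every gap between thresholds and `B` bounds the speed, so crossing a gap takes
  -- at least `δ / B`.
  refine ⟨δ / B, div_pos hδ0 hB0, fun j t t' l l' ⟨⟨h1, h2, hne⟩, ⟨h1', h2', hne'⟩, hll, hno⟩ => ?_⟩
  have hσ := σ_eq_of_forall_not_isSwitch h (j := j) h2 h1' hll
    fun r k hk hk' => hno r k hk hk'
  have hjump := h.jump_eq t l h1 h2
  have hjump' := h.jump_eq t' l' h1' h2'
  have hM := hV.mem h h1
  have hM' := hV.mem h h1'
  have hns : S.NeedsSwitch (ζ t l) j :=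
    needsSwitch_of_switchUpdate_ne hM (by rw [hjump] at hne; exact hne)
  have hns' : S.NeedsSwitch (ζ t' l') j :=
    needsSwitch_of_switchUpdate_ne hM' (by rw [hjump'] at hne'; exact hne')
  have htt : t ≤ t' := h.domain.le_of_lt h1 h1' hll
  -- Coordinates are 1-Lipschitz for the sup norm on states, so the bound `B` on the field also
  -- bounds their speed.
  have hω : |S.ω (ζ t' l') j - S.ω (ζ t l) j| ≤ B * (t' - t) :=
    h.abs_sub_le hC hV.isGlobalFlow hB (q := fun z => S.ω z j)
      (fun x y => (norm_le_pi_norm (x - y).2.1 j).trans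
        ((norm_fst_le _).trans (norm_snd_le _))) (fun z => rfl) h1 h1' htt hll.le
  have hp : |S.pc (ζ t' l') j - S.pc (ζ t l) j| ≤ B * (t' - t) :=
    h.abs_sub_le hC hV.isGlobalFlow hB (q := fun z => S.pc z j)
      (fun x y => (norm_le_pi_norm (x - y).2.2.2.1 j).trans
        ((norm_fst_le _).trans ((norm_snd_le _).trans ((norm_snd_le _).trans (norm_snd_le _)))))
      (fun z => rfl) h1 h1' htt hll.le
  rw [div_le_iff₀ hB0, mul_comm]
  obtain ⟨hδ1, hδ2⟩ := hδ j
  have hM2 := hV.mem h h2 j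
  rw [abs_le] at hω hp
  -- Two switches in the same direction contradict `hσ`, as `σ j` keeps its new value in between.
  -- Opposite directions force `ω j` or `pc j` across its gap.
  rcases hns with ⟨hv, hns⟩ | ⟨hv, hns, hns2⟩ <;>
    rcases hns' with ⟨hv', hns'⟩ | ⟨hv', hns', hns2'⟩
  · rcases hM2 with hM2 | hM2
    · exact absurd (hM2.trans hv.symm) hne
    · rw [hv', hM2] at hσ; norm_num at hσ
  · rcases hns with hns | hns <;> linarith
  · rcases hns' with hns' | hns' <;> linarith
  · rcases hM2 with hM2 | hM2
    · rw [hv', hM2] at hσ; norm_num at hσ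
    · exact absurd (hM2.trans hv.symm) hne

/-- Pigeonhole: each jump switches some load, and a load switches at most once in each time window
of length `τ`. -/
theorem exists_jump_bound (h : S.hybridSystem.IsSolution K ζ) {τ : ℝ} (hτ : 0 < τ)
    (hdwell : ∀ (j : N) (t t' : ℝ) (l l' : ℕ),
      S.AreConsecutiveSwitches K ζ j t l t' l' → τ ≤ t' - t) (T : ℝ) :
    ∃ L : ℕ, ∀ (t : ℝ) (l : ℕ), (t, l) ∈ K → t ≤ T → l ≤ L := by
  obtain ⟨t, h0, ht, -, hleft, -, hpred⟩ := h.domain.exists_jumpTimes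
  -- The separation passes from consecutive to arbitrary switches of a load by comparing with the
  -- first switch after `k`.
  have hsep : ∀ (j : N) (s s' : ℝ) (k k' : ℕ), k < k' → S.IsSwitch K ζ j s k →
      S.IsSwitch K ζ j s' k' → τ ≤ s' - s := by
    intro j s s' k k' hk hs hs'
    classical
    have hex : ∃ m, k < m ∧ ∃ r, S.IsSwitch K ζ j r m := ⟨k', hk, s', hs'⟩
    obtain ⟨hm, r, hr⟩ := Nat.find_spec hex
    have h1 : τ ≤ r - s := hdwell j s r k _ ⟨hs, hr, hm, fun r' m hm1 hm2 hsw =>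
      Nat.find_min hex hm2 ⟨hm1, r', hsw⟩⟩
    have h2 : r ≤ s' := by
      rcases (Nat.find_min' hex ⟨hk, s', hs'⟩).lt_or_eq with hlt | heq
      · exact h.domain.le_of_lt hr.1 hs'.1 hlt
      · have hr1 := hr.1
        rw [heq] at hr1
        exact h.domain.le_of_lt hr1 hs'.2.1 k'.lt_succ_self
    linarith
  refine ⟨Fintype.card N * (⌊T / τ⌋₊ + 1), fun s l hs hsT => ?_⟩
  have hmem : ∀ k, k < l → (t (k + 1), k) ∈ K ∧ (t (k + 1), k + 1) ∈ K ∧ t (k + 1) ≤ s := by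
    clear hsT
    induction l generalizing s with
    | zero => exact fun k hk => absurd hk k.not_lt_zero
    | succ l ih =>
      intro k hk
      obtain ⟨hle, hmem⟩ := hleft s _ hs
      have hmem' := (hpred s l hs).1
      rcases (Nat.le_of_lt_succ hk).lt_or_eq with hk | rfl
      · obtain ⟨h1, h2, h3⟩ := ih _ hmem' k hk
        exact ⟨h1, h2, h3.trans hle⟩
      · exact ⟨hmem', hmem, hle⟩
  have hsw : ∀ k : Fin l, ∃ j, S.IsSwitch K ζ j (t (k + 1)) k := fun k => by
    obtain ⟨h1, h2, -⟩ := hmem k k.2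
    obtain ⟨-, j, hj⟩ := mem_jumpRegion_iff.1 (h.jump_mem _ _ h1 h2)
    refine ⟨j, h1, h2, ?_⟩
    rw [h.jump_eq _ _ h1 h2]
    exact hj.switchUpdate_ne
  choose J hJ using hsw
  have hnn : ∀ k : ℕ, 0 ≤ t k := fun k => h0 ▸ ht (Nat.zero_le k)
  -- A jump is labelled by a load that switches there and the window `[nτ, (n+1)τ)` containing its
  -- time. Up to `T` there are `⌊T / τ⌋₊ + 1` windows, and `hsep` makes the labelling injective.
  let F : Fin l → N × Fin (⌊T / τ⌋₊ + 1) := fun k =>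
    (J k, ⟨⌊t (k + 1) / τ⌋₊, Nat.lt_succ_of_le (Nat.floor_le_floor
      (div_le_div_of_nonneg_right ((hmem k k.2).2.2.trans hsT) hτ.le))⟩)
  have hlt : ∀ k k' : Fin l, k < k' → F k ≠ F k' := by
    intro k k' hk heq
    have hj : J k = J k' := congrArg Prod.fst heq
    have hfl : ⌊t (k + 1) / τ⌋₊ = ⌊t (k' + 1) / τ⌋₊ :=
      congrArg (fun p => (p.2 : ℕ)) heq
    have h1 := hsep (J k) _ _ k k' hk (hJ k) (hj ▸ hJ k')
    have h2 : ⌊t (k + 1) / τ⌋₊ + 1 ≤ ⌊t (k' + 1) / τ⌋₊ := by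
      rw [← Nat.floor_add_one (div_nonneg (hnn _) hτ.le)]
      refine Nat.floor_le_floor ?_
      rw [div_add_one hτ.ne']
      exact div_le_div_of_nonneg_right (by linarith) hτ.le
    omega
  have hinj : Function.Injective F := fun k k' heq => by
    rcases lt_trichotomy k k' with hk | hk | hk
    · exact absurd heq (hlt k k' hk)
    · exact hk
    · exact absurd heq.symm (hlt k' k hk)
  simpa using Fintype.card_le_of_injective F hinj

end PowerNetwork

theorem mainTheorem12 {N : Type*} [Fintype N] [DecidableEq N] (S : PowerNetwork N) :
    -- existence of complete solutions from every initial condition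
    (∀ z₀ ∈ S.stateSpace, ∃ (K : Set (ℝ × ℕ)) (ζ : ℝ → ℕ → S.State),
      S.hybridSystem.IsCompleteSolution K ζ ∧ ζ 0 0 = z₀) ∧
    -- all maximal solutions are complete
    (∀ (K : Set (ℝ × ℕ)) (ζ : ℝ → ℕ → S.State),
      S.hybridSystem.IsMaximalSolution K ζ → S.hybridSystem.IsCompleteSolution K ζ) ∧
    -- for complete bounded solutions: three consecutive switches of a load span at least time `τ`,
    -- and only finitely many jumps occur in bounded time
    (∀ (K : Set (ℝ × ℕ)) (ζ : ℝ → ℕ → S.State),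
      S.hybridSystem.IsCompleteSolution K ζ → IsBoundedOn K ζ →
        (∃ τ : ℝ, 0 < τ ∧ ∀ (j : N) (t₁ t₂ t₃ : ℝ) (l₁ l₂ l₃ : ℕ),
          S.AreConsecutiveSwitches K ζ j t₁ l₁ t₂ l₂ →
          S.AreConsecutiveSwitches K ζ j t₂ l₂ t₃ l₃ →
          τ ≤ t₃ - t₁) ∧
        (∀ T : ℝ, ∃ L : ℕ, ∀ (t : ℝ) (l : ℕ), (t, l) ∈ K → t ≤ T → l ≤ L)) := by
  obtain ⟨Φ, hΦ⟩ := S.exists_isGlobalFlow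
  have hV := PowerNetwork.isViable hΦ
  refine ⟨fun z₀ hz₀ => hV.exists_isCompleteSolution hz₀,
    fun K ζ h => hV.isCompleteSolution_of_isMaximalSolution h, fun K ζ h hb => ?_⟩
  obtain ⟨τ, hτ, hdwell⟩ := PowerNetwork.exists_dwellTime h.1 hb
  refine ⟨⟨τ, hτ, fun j t₁ t₂ t₃ l₁ l₂ l₃ h₁₂ h₂₃ => ?_⟩,
    PowerNetwork.exists_jump_bound h.1 hτ hdwell⟩
  have h1 := hdwell _ _ _ _ _ h₁₂
  have h2 := hdwell _ _ _ _ _ h₂₃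
  linarith
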